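/- Conventions. A represented space is a set $X$ with a surjective partial map $\delta_X:\subseteq\mathbb N^{\mathbb N}\to X$; a problem $f:\subseteq X\rightrightarrows Y$ is a partial multi-valued map between represented spaces, with $\operatorname{dom}(f)=\{x: f(x)\neq\emptyset\}$. A partial function $F:\subseteq\mathbb N^{\mathbb N}\to\mathbb N^{\mathbb N}$ is a realizer of $f$, written $F\vdash f$, if $\delta_Y(F(p))\in f(\delta_X(p))$ for all $p\in\operatorname{dom}(f\delta_X)$. Problem $f$ is Weihrauch reducible to $g$, written $f\le_{\mathrm W} g$, if there are computable $H,K:\subseteq\mathbb N^{\mathbb N}\to\mathbb N^{\mathbb N}$ such that $p\mapsto H\langle p,G(K(p))\rangle$ is a realizer of $f$ for every $G\vdash g$; and $f\equiv_{\mathrm W}g$ means $f\le_{\mathrm W}g$ and $g\le_{\mathrm W}f$. Composition $g\circ f$ of problems has domain $\{x\in\operatorname{dom}(f): f(x)\subseteq\operatorname{dom}(g)\}$ and values $\bigcup_{y\in f(x)}g(y)$. For a represented space $(X,\delta_X)$ the completion is $\overline X=X\cup\{\bot\}$ with $\delta_{\overline X}(p)=\delta_X(p-1)$ if $p-1$ is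 an infinite sequence in $\operatorname{dom}(\delta_X)$ and $\delta_{\overline X}(p)=\bot$ otherwise, where $p-1$ arises from $p$ by deleting all zeros and subtracting one from all other entries. The completion of $f:\subseteq X\rightrightarrows Y$ is $\overline f:\overline X\rightrightarrows\overline Y$ with $\overline f(x)=f(x)$ for $x\in\operatorname{dom}(f)$ and $\overline f(x)=\overline Y$ otherwise; $f$ is complete if $f\equiv_{\mathrm W}\overline f$. The spaces $\mathbb N^{\mathbb N}$ and $2^{\mathbb N}$ are represented by (restrictions of) the identity, $\mathbb N$ by $p\mapsto p(0)$, and the space $\mathcal A_-(\mathbb N)$ of (closed) subsets of $\mathbb N$ by $p\mapsto\mathbb N\setminus\{n: n+1\in\operatorname{range}(p)\}$. Consider the following problems. - $\mathsf{Low}:=\mathsf J^{-1}\circ\lim:\subseteq\mathbb N^{\mathbb N}\to\mathbb N^{\mathbb N}$, where $\mathsf J(p)=p'$ is the Turing jump and $\lim\langle p_0,p_1,p_2,\dots\rangle=\lim_{n\to\infty}p_n$ for sequences converging in $\mathbb N^{\mathbb N}$. - $\mathsf{WBWT}_2:2^{\mathbb N}\rightrightarrows 2^{\mathbb N}$, $p\mapsto\{q\in2^{\mathbb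 N}:\lim_{n\to\infty}q(n)\text{ exists and is a cluster point of }p\}$. - $\mathsf C_{\mathbb N}:\subseteq\mathcal A_-(\mathbb N)\rightrightarrows\mathbb N$, $A\mapsto A$, with domain $\{A: A\neq\emptyset\}$. - $\mathsf{SORT}:2^{\mathbb N}\to2^{\mathbb N}$, where $\mathsf{SORT}(p)=0^k111\cdots$ if $p$ contains exactly $k\in\mathbb N$ zeros and $\mathsf{SORT}(p)=000\cdots$ if $p$ contains infinitely many zeros. Theorem. $\mathsf{WBWT}_2\not\le_{\mathrm W}\mathsf{Low}$. Moreover, $\mathsf{Low}$ is not complete, $\overline{\mathsf C_{\mathbb N}}\not\le_{\mathrm W}\mathsf{Low}$ and $\mathsf{SORT}\not\le_{\mathrm W}\mathsf{Low}$. -/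

import Mathlib

open Filter Topology

namespace Weihrauch

/-! ### Baire space and computable functions on it -/

/-- Baire space `ℕ^ℕ`; it carries the product topology of the discrete topology. -/
abbrev Baire : Type := ℕ → ℕ

/-- The prefix `p(0), …, p(n-1)` of `p`. -/
def pre (p : Baire) (n : ℕ) : List ℕ := (List.range n).map p

/-- A partial function on Baire space is computable if it is induced by a computable word function
that is monotone for the prefix order: for every `p` in the domain of `F`, the words `φ (pre p n)`
are longer and longer prefixes of `F p`. -/
def IsComputable (F : Baire →. Baire) : Prop :=
  ∃ φ : List ℕ → List ℕ, Computable φ ∧ (∀ u v, u <+: v → φ u <+: φ v) ∧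
    ∀ p, ∀ q ∈ F p, ∀ k, ∃ n, pre q k <+: φ (pre p n)

/-- The pairing `⟨p, q⟩(2n) = p(n)`, `⟨p, q⟩(2n+1) = q(n)` of Baire space. -/
def interleave (p q : Baire) : Baire := fun n => if Even n then p (n / 2) else q (n / 2)

/-- `ceIn i p` is the `i`-th set `W_i^p` of natural numbers that is computably enumerable relative
to `p`: the number `n` belongs to it if the `i`-th program halts on `n` together with some finite
prefix of the oracle `p`. -/
def ceIn (i : ℕ) (p : Baire) : Set ℕ :=
  {n | ∃ k, ((Denumerable.ofNat Nat.Partrec.Code i).eval (Encodable.encode (pre p k, n))).Dom}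

open Classical in
/-- The Turing jump `J : ℕ^ℕ → ℕ^ℕ`, `p ↦ p'`, where `p'` is the characteristic function of
`{i | i ∈ W_i^p}`. -/
noncomputable def jump (p : Baire) : Baire := fun i => if i ∈ ceIn i p then 1 else 0

/-! ### Represented spaces and problems -/

/-- A represented space: a set with a surjective partial map from Baire space onto it. -/
class RepresentedSpace (X : Type*) where
  /-- the representation -/
  rep : Baire →. X
  /-- every point has a name -/
  rep_surj : ∀ x, ∃ p, x ∈ rep p

open RepresentedSpace

/-- A problem `f :⊆ X ⇉ Y`, i.e. a partial multi-valued map; its domain consists of the points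
`x` with `f x ≠ ∅`. -/
def Problem (X Y : Type*) : Type _ := X → Set Y

section Problems

variable {X Y Z U V : Type*}

/-- The domain of a problem. -/
def Problem.dom (f : Problem X Y) : Set X := {x | (f x).Nonempty}

/-- Composition `g ∘ f` of problems, with domain `{x ∈ dom f | f x ⊆ dom g}`. -/
def Problem.comp (g : Problem Y Z) (f : Problem X Y) : Problem X Z :=
  fun x => {z | f x ⊆ g.dom ∧ ∃ y ∈ f x, z ∈ g y}

/-- `F ⊢ f`: the partial function `F` on Baire space is a realizer of `f`. -/
def Realizes [RepresentedSpace X] [RepresentedSpace Y] (F : Baire →. Baire) (f : Problem X Y) :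
    Prop :=
  ∀ p, ∀ x ∈ (rep p : Part X), x ∈ f.dom → ∃ q ∈ F p, ∃ y ∈ (rep q : Part Y), y ∈ f x

/-- Weihrauch reducibility `f ≤_W g`: there are computable partial functions `H`, `K` such that
`p ↦ H⟨p, G(K(p))⟩` is a realizer of `f` for every realizer `G` of `g`. -/
def Reducible [RepresentedSpace X] [RepresentedSpace Y] [RepresentedSpace U] [RepresentedSpace V]
    (f : Problem X Y) (g : Problem U V) : Prop :=
  ∃ H K : Baire →. Baire, IsComputable H ∧ IsComputable K ∧
    ∀ G : Baire →. Baire, Realizes G g →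
      Realizes (fun p => (K p).bind fun r => (G r).bind fun q => H (interleave p q)) f

end Problems

/-! ### Completion -/

/-- The partial map `p ↦ p - 1`: delete all zeros from `p` and subtract one from the remaining
entries. It is defined if the result is an infinite sequence. -/
noncomputable def decr : Baire →. Baire := fun p =>
  ⟨{n | p n ≠ 0}.Infinite, fun _ k => p (Nat.nth (fun n => p n ≠ 0) k) - 1⟩

/-- The precompletion `p ↦ δ(p - 1)` of the representation `δ` of a represented space. -/
noncomputable def precompletion (X : Type*) [RepresentedSpace X] : Baire →. X :=
  fun p => (decr p).bind RepresentedSpace.rep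

/-- Every name `p` of a point has `p + 1` as a name for the precompletion. -/
theorem decr_succ (p : Baire) : p ∈ decr (fun n => p n + 1) := by
  refine ⟨?_, ?_⟩
  · change {n | p n + 1 ≠ 0}.Infinite
    simpa using Set.infinite_univ (α := ℕ)
  · funext k
    have h : Nat.nth (fun n => p n + 1 ≠ 0) k = k := by
      have : (fun n => p n + 1 ≠ 0) = fun _ => True := by funext n; simp
      rw [this, Nat.nth_true]
    change p (Nat.nth (fun n => p n + 1 ≠ 0) k) + 1 - 1 = p k
    rw [h, Nat.add_sub_cancel]

/-- The completion of `X` is `X ∪ {⊥}`, with `⊥` written as `none`. -/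
abbrev Completion (X : Type*) : Type _ := Option X

open Classical in
/-- The total representation of the completion: `p` is a name of the point given by the
precompletion if there is one, and a name of `⊥` otherwise. -/
noncomputable instance (X : Type*) [RepresentedSpace X] : RepresentedSpace (Completion X) where
  rep p := Part.some (precompletion X p).toOption
  rep_surj := by
    rintro (_ | x)
    · refine ⟨fun _ => 0, Part.mem_some_iff.2 (Part.toOption_eq_none_iff.2 ?_).symm⟩
      rintro ⟨h, -⟩
      exact h (by simp)
    · obtain ⟨p, hp⟩ := RepresentedSpace.rep_surj x
      exact ⟨fun n => p n + 1, Part.mem_some_iff.2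
        (Part.toOption_eq_some_iff.2 (Part.mem_bind (decr_succ p) hp)).symm⟩

open Classical in
/-- The completion of a problem `f`: it agrees with `f` on `dom f`, and every point of the
completion of `Y` is a solution for any other input, in particular for the input `⊥`. -/
noncomputable def Problem.completion {X Y : Type*} (f : Problem X Y) :
    Problem (Completion X) (Completion Y)
  | none => Set.univ
  | some x => if x ∈ f.dom then some '' f x else Set.univ

/-- A problem is complete if it is Weihrauch equivalent to its completion. -/
def Problem.IsComplete {X Y : Type*} [RepresentedSpace X] [RepresentedSpace Y]
    (f : Problem X Y) : Prop :=
  Reducible f f.completion ∧ Reducible f.completion f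

/-! ### The concrete represented spaces -/

/-- Baire space is represented by the identity. -/
instance : RepresentedSpace Baire where
  rep p := Part.some p
  rep_surj x := ⟨x, Part.mem_some x⟩

/-- Cantor space `2^ℕ` is represented by the restriction of the identity to binary sequences. -/
instance : RepresentedSpace (ℕ → Bool) where
  rep p := ⟨∀ n, p n = 0 ∨ p n = 1, fun _ n => decide (p n = 1)⟩
  rep_surj x := by
    refine ⟨fun n => (x n).toNat, ?_, ?_⟩
    · intro n
      cases h : x n <;> simp
    · funext n
      cases h : x n <;> simp [h]

/-- The natural numbers are represented by `p ↦ p(0)`. -/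
instance : RepresentedSpace ℕ where
  rep p := Part.some (p 0)
  rep_surj x := ⟨fun _ => x, Part.mem_some x⟩

/-- The space of closed subsets of `ℕ` with negative information: `p` is a name of the complement
of `{n | n + 1 ∈ range p}`. -/
instance : RepresentedSpace (TopologicalSpace.Closeds ℕ) where
  rep p := Part.some ⟨{n | n + 1 ∉ Set.range p}, isClosed_discrete _⟩
  rep_surj A := by
    classical
    refine ⟨fun n => if n ∈ A then 0 else n + 1, ?_⟩
    rw [Part.mem_some_iff]
    ext n
    change n ∈ A ↔ n + 1 ∉ Set.range fun n => if n ∈ A then 0 else n + 1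
    constructor
    · rintro hn ⟨m, hm⟩
      by_cases hmA : m ∈ A
      · simp [hmA] at hm
      · simp only [hmA, if_false, Nat.add_right_cancel_iff] at hm
        exact hmA (hm ▸ hn)
    · intro h
      by_contra hn
      exact h ⟨n, by simp [hn]⟩

/-! ### The concrete problems -/

/-- `lim ⟨p₀, p₁, p₂, …⟩ = lim pₙ`, where `⟨p₀, p₁, …⟩⟨n, k⟩ = pₙ(k)`; its domain consists of
the (encoded) sequences that converge in Baire space. -/
def limBaire : Problem Baire Baire := fun p =>
  {q | Tendsto (fun n : ℕ => (fun k => p (Nat.pair n k) : Baire)) atTop (𝓝 q)}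

/-- The partial inverse `J⁻¹` of the Turing jump. -/
def jumpInv : Problem Baire Baire := fun q => {p | jump p = q}

/-- The low map `J⁻¹ ∘ lim`. -/
def Low : Problem Baire Baire := jumpInv.comp limBaire

/-- The weak Bolzano–Weierstraß problem on `{0, 1}`: given a binary sequence `p`, find a convergent
binary sequence whose limit is a cluster point of `p`. -/
def WBWT2 : Problem (ℕ → Bool) (ℕ → Bool) := fun p =>
  {q | ∃ i : Bool, Tendsto q atTop (𝓝 i) ∧ MapClusterPt i atTop p}

/-- Choice on the natural numbers: find an element of a given non-empty (closed) set. -/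
def choiceNat : Problem (TopologicalSpace.Closeds ℕ) ℕ := fun A => (A : Set ℕ)

open Classical in
/-- The binary sorting problem: a sequence with exactly `k` zeros is mapped to `0^k 1 1 1 …`, a
sequence with infinitely many zeros to `0 0 0 …`. -/
noncomputable def SORT : Problem (ℕ → Bool) (ℕ → Bool) := fun p =>
  {if {n | p n = false}.Finite then fun n => decide ({m | p m = false}.ncard ≤ n)
    else fun _ => false}

end Weihrauch

/-! Only the irreducibility of `WBWT2` to `Low` needs a diagonal argument. The other claims follow
by transitivity, since `WBWT2` reduces to `SORT` and to the completions of `choiceNat` and `Low`.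

Suppose H and K reduce `WBWT2` to `Low`. For a solution q, K(p) converges to the jump of q, so Σ₁
questions about q are decided in the limit while p is still being built. Since s = H⟨p, q⟩ converges
to a bit, some j is valid in the sense that s is constantly j % 2 from position j / 2 on; for
computable p, invalidity of j is c.e. in q. Let p(n) be opposite to the parity of the least j that
currently looks valid. The answers for all numbers up to the least valid j stabilize, so p is
eventually the bit opposite to lim s, which is then no cluster point of p. The circularity (p needs
indices of c.e. sets that are defined from p) is resolved by the recursion theorem in
`exists_code_refutes`; `not_reducible_wbwt2_low` runs the argument.

For the completions, ask for a position from which p is constantly 1 (`wbwt2_reducible_completion`).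
If there is one, the instance is legitimate and the answer correct. If not, the completion still
answers something, possibly ⊥, but every proposed bound is eventually refuted by p. Writing 1 while
the proposal survives and 0 otherwise solves `WBWT2` in both cases. -/

namespace Weihrauch

open RepresentedSpace
open Nat.Partrec (Code)

/-! ### Words and prefixes -/

@[simp]
theorem length_pre (p : Baire) (n : ℕ) : (pre p n).length = n := by simp [pre]

theorem getElem?_pre {p : Baire} {n i : ℕ} (h : i < n) : (pre p n)[i]? = some (p i) := by
  simp [pre, h]

theorem getD_pre {p : Baire} {n i : ℕ} (h : i < n) : (pre p n).getD i 0 = p i := by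
  simp [getElem?_pre h]

theorem pre_succ (p : Baire) (n : ℕ) : pre p (n + 1) = pre p n ++ [p n] := by
  simp [pre, List.range_succ]

theorem pre_prefix_pre (p : Baire) {m n : ℕ} (h : m ≤ n) : pre p m <+: pre p n := by
  induction n, h using Nat.le_induction with
  | base => exact List.prefix_rfl
  | succ n _ ih => exact ih.trans (by rw [pre_succ]; exact List.prefix_append _ _)

theorem take_pre (p : Baire) {m n : ℕ} (h : m ≤ n) : (pre p n).take m = pre p m := by
  have := pre_prefix_pre p h
  rw [List.prefix_iff_eq_take] at this
  simpa using this.symm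

/-- Padding `v` by zeros turns both words into prefixes of one sequence, so monotonicity of word
functions need only be checked on `pre`. -/
theorem eq_pre_of_prefix {u v : List ℕ} (h : u <+: v) :
    u = pre (fun n => v.getD n 0) u.length := by
  refine List.ext_getElem (by simp) fun i h₁ _ => ?_
  have hv : i < v.length := h₁.trans_le h.length_le
  simp [pre, hv, h.getElem h₁]

theorem getElem?_of_prefix_pre {w : List ℕ} {p : Baire} {n i : ℕ} (h : w <+: pre p n)
    (hi : i < w.length) : w[i]? = some (p i) := by
  have hn : i < n := by simpa using hi.trans_le h.length_le
  rw [List.getElem?_eq_getElem hi, h.getElem hi]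
  simp [pre]

theorem getElem?_of_pre_prefix {w : List ℕ} {p : Baire} {n i : ℕ} (h : pre p n <+: w)
    (hi : i < n) : w[i]? = some (p i) := by
  have hl : i < (pre p n).length := by simpa using hi
  rw [List.getElem?_eq_getElem (hl.trans_le h.length_le), ← h.getElem hl]
  simp [pre]

/-- Words computed from prefixes of a point of the domain are prefixes of the value. -/
theorem prefix_pre_of_approx {φ : List ℕ → List ℕ} (mono : ∀ u v, u <+: v → φ u <+: φ v)
    {p q : Baire} (h : ∀ k, ∃ n, pre q k <+: φ (pre p n)) (n : ℕ) :
    φ (pre p n) <+: pre q (φ (pre p n)).length := by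
  obtain ⟨m, hm⟩ := h (φ (pre p n)).length
  have h₁ := mono _ _ (pre_prefix_pre p (le_max_left n m))
  have h₂ := hm.trans (mono _ _ (pre_prefix_pre p (le_max_right n m)))
  exact List.prefix_of_prefix_length_le h₁ h₂ (by simp)

/-! ### Pairing -/

/-- The even-indexed entries. -/
def evens (s : Baire) : Baire := fun n => s (2 * n)

/-- The odd-indexed entries. -/
def odds (s : Baire) : Baire := fun n => s (2 * n + 1)

@[simp]
theorem evens_interleave (p q : Baire) : evens (interleave p q) = p := by
  funext n; simp [evens, interleave]

@[simp]
theorem odds_interleave (p q : Baire) : odds (interleave p q) = q := by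
  funext n
  have : (2 * n + 1) / 2 = n := by omega
  simp [odds, interleave, this]

/-- The pairing of words, truncated to the shorter one. -/
def interleaveWord (u v : List ℕ) : List ℕ :=
  (List.range (2 * min u.length v.length)).map fun n =>
    if n % 2 = 0 then u.getD (n / 2) 0 else v.getD (n / 2) 0

theorem interleaveWord_pre (p q : Baire) (m n : ℕ) :
    interleaveWord (pre p m) (pre q n) = pre (interleave p q) (2 * min m n) := by
  refine (List.map_congr_left fun i hi => ?_).trans (by rw [length_pre, length_pre]; rfl)
  have hi' : i < 2 * min m n := by simpa using hi
  rw [getD_pre (by omega), getD_pre (by omega)]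
  simp [interleave, Nat.even_iff]

theorem interleaveWord_mono {u u' v v' : List ℕ} (hu : u <+: u') (hv : v <+: v') :
    interleaveWord u v <+: interleaveWord u' v' := by
  have e₁ := eq_pre_of_prefix (List.prefix_refl u')
  have e₂ := eq_pre_of_prefix (List.prefix_refl v')
  have h₁ := hu.length_le
  have h₂ := hv.length_le
  rw [eq_pre_of_prefix hu, eq_pre_of_prefix hv, interleaveWord_pre]
  conv_rhs => rw [e₁, e₂]
  rw [interleaveWord_pre]
  exact pre_prefix_pre _ (by omega)

theorem primrec₂_interleaveWord : Primrec₂ interleaveWord := by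
  have h2 : Primrec fun x : (List ℕ × List ℕ) × ℕ => x.2 / 2 :=
    Primrec.nat_div.comp Primrec.snd (Primrec.const 2)
  refine Primrec.list_map (Primrec.list_range.comp (Primrec.nat_mul.comp (Primrec.const 2)
    (Primrec.nat_min.comp (Primrec.list_length.comp Primrec.fst)
      (Primrec.list_length.comp Primrec.snd)))) ?_
  exact Primrec.ite (Primrec.eq.comp (Primrec.nat_mod.comp Primrec.snd (Primrec.const 2))
      (Primrec.const 0))
    ((Primrec.list_getD 0).comp (Primrec.fst.comp Primrec.fst) h2)
    ((Primrec.list_getD 0).comp (Primrec.snd.comp Primrec.fst) h2)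

/-! ### Computable functions on Baire space -/

theorem IsComputable.comp {F G : Baire →. Baire} (hG : IsComputable G) (hF : IsComputable F) :
    IsComputable fun p => (F p).bind G := by
  obtain ⟨φ, hφ, φmono, φF⟩ := hF
  obtain ⟨ψ, hψ, ψmono, ψG⟩ := hG
  refine ⟨fun u => ψ (φ u), hψ.comp hφ, fun u v h => ψmono _ _ (φmono _ _ h), ?_⟩
  intro p r hr k
  obtain ⟨q, hq, hr⟩ := Part.mem_bind_iff.1 hr
  obtain ⟨m, hm⟩ := ψG q r hr k
  obtain ⟨n, hn⟩ := φF p q hq m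
  exact ⟨n, hm.trans (ψmono _ _ hn)⟩

theorem IsComputable.interleave {F G : Baire →. Baire} (hF : IsComputable F)
    (hG : IsComputable G) :
    IsComputable fun p => (F p).bind fun a => (G p).map (interleave a) := by
  obtain ⟨φ, hφ, φmono, φF⟩ := hF
  obtain ⟨ψ, hψ, ψmono, ψG⟩ := hG
  refine ⟨fun u => interleaveWord (φ u) (ψ u), primrec₂_interleaveWord.to_comp.comp hφ hψ,
    fun u v h => interleaveWord_mono (φmono _ _ h) (ψmono _ _ h), ?_⟩
  intro p r hr k
  obtain ⟨a, ha, hr⟩ := Part.mem_bind_iff.1 hr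
  obtain ⟨b, hb, rfl⟩ := (Part.mem_map_iff _).1 hr
  obtain ⟨m, hm⟩ := φF p a ha k
  obtain ⟨n, hn⟩ := ψG p b hb k
  refine ⟨max m n, (pre_prefix_pre _ (by omega : k ≤ 2 * min k k)).trans ?_⟩
  rw [← interleaveWord_pre]
  exact interleaveWord_mono (hm.trans (φmono _ _ (pre_prefix_pre _ (le_max_left _ _))))
    (hn.trans (ψmono _ _ (pre_prefix_pre _ (le_max_right _ _))))

/-- A total function whose `n`-th value is computed from the first `2 * n + 2` entries of the
argument is computable. -/
theorem isComputable_of_prefix {F : Baire → Baire} {h : List ℕ → ℕ} (hh : Primrec h)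
    (hF : ∀ p n, F p n = h (pre p (2 * n + 2))) : IsComputable fun p => Part.some (F p) := by
  have key : ∀ p n, (List.range ((pre p n).length / 2)).map
      (fun i => h ((pre p n).take (2 * i + 2))) = pre (F p) (n / 2) := by
    intro p n
    rw [length_pre]
    refine List.map_congr_left fun i hi => ?_
    have : i < n / 2 := List.mem_range.1 hi
    rw [take_pre _ (by omega), hF]
  refine ⟨fun u => (List.range (u.length / 2)).map fun i => h (u.take (2 * i + 2)), ?_, ?_, ?_⟩
  · refine Primrec.to_comp (Primrec.list_map (Primrec.list_range.comp
      (Primrec.nat_div.comp Primrec.list_length (Primrec.const 2))) (hh.comp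
        (Primrec.list_take.comp ?_ Primrec.fst)))
    exact Primrec.nat_add.comp (Primrec.nat_mul.comp (Primrec.const 2) Primrec.snd)
      (Primrec.const 2)
  · intro u v huv
    have e := eq_pre_of_prefix (List.prefix_refl v)
    rw [eq_pre_of_prefix huv]
    conv_rhs => rw [e]
    beta_reduce
    rw [key, key]
    exact pre_prefix_pre _ (Nat.div_le_div_right huv.length_le)
  · intro p q hq k
    rw [Part.mem_some_iff.1 hq]
    exact ⟨2 * k, by beta_reduce; rw [key]; exact pre_prefix_pre _ (by omega)⟩

theorem isComputable_evens : IsComputable fun s => Part.some (evens s) :=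
  isComputable_of_prefix (h := fun u => u.getD (u.length - 2) 0)
    ((Primrec.list_getD 0).comp Primrec.id
      (Primrec.nat_sub.comp Primrec.list_length (Primrec.const 2)))
    fun p n => by rw [length_pre, getD_pre (by omega)]; rfl

theorem isComputable_odds : IsComputable fun s => Part.some (odds s) :=
  isComputable_of_prefix (h := fun u => u.getD (u.length - 1) 0)
    ((Primrec.list_getD 0).comp Primrec.id
      (Primrec.nat_sub.comp Primrec.list_length (Primrec.const 1)))
    fun p n => by rw [length_pre, getD_pre (by omega)]; rfl

/-! ### Weihrauch reducibility -/

theorem Reducible.trans {X Y U V Z W : Type*} [RepresentedSpace X] [RepresentedSpace Y]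
    [RepresentedSpace U] [RepresentedSpace V] [RepresentedSpace Z] [RepresentedSpace W]
    {f : Problem X Y} {g : Problem U V} {h : Problem Z W} (hfg : Reducible f g)
    (hgh : Reducible g h) : Reducible f h := by
  obtain ⟨H₀, K₀, hH₀, hK₀, hr₀⟩ := hfg
  obtain ⟨H₁, K₁, hH₁, hK₁, hr₁⟩ := hgh
  -- The outer functional maps ⟨p, q⟩ to H₀⟨p, H₁⟨K₀ p, q⟩⟩.
  refine ⟨_, _, hH₀.comp (isComputable_evens.interleave
    (hH₁.comp ((hK₀.comp isComputable_evens).interleave isComputable_odds))),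
    hK₁.comp hK₀, fun G hG => ?_⟩
  intro p x hx hxf
  obtain ⟨s, hs, y, hy, hyf⟩ := hr₀ _ (hr₁ G hG) p x hx hxf
  refine ⟨s, ?_, y, hy, hyf⟩
  simp only [Part.mem_bind_iff] at hs
  obtain ⟨r, hr, q, ⟨r', hr', q', hq', hq⟩, hs⟩ := hs
  refine Part.mem_bind_iff.2 ⟨r', Part.mem_bind_iff.2 ⟨r, hr, hr'⟩,
    Part.mem_bind_iff.2 ⟨q', hq', Part.mem_bind_iff.2 ⟨interleave p q, ?_, hs⟩⟩⟩
  refine Part.mem_bind_iff.2 ⟨p, by simp, (Part.mem_map_iff _).2 ⟨q, ?_, rfl⟩⟩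
  refine Part.mem_bind_iff.2 ⟨interleave r q', ?_, hq⟩
  exact Part.mem_bind_iff.2 ⟨r, Part.mem_bind_iff.2 ⟨p, by simp, hr⟩,
    (Part.mem_map_iff _).2 ⟨q', by simp, rfl⟩⟩

/-- Every problem has a realizer that is defined only on names of points of the domain and sends
them to names of solutions. -/
theorem exists_realizer {X Y : Type*} [RepresentedSpace X] [RepresentedSpace Y]
    (f : Problem X Y) : ∃ G : Baire →. Baire, Realizes G f ∧
      ∀ p, ∀ q ∈ G p, ∃ x ∈ (rep p : Part X), ∃ y ∈ (rep q : Part Y), y ∈ f x := by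
  have h : ∀ p, (∃ x ∈ (rep p : Part X), x ∈ f.dom) →
      ∃ q, ∃ x ∈ (rep p : Part X), ∃ y ∈ (rep q : Part Y), y ∈ f x := by
    rintro p ⟨x, hx, y, hy⟩
    obtain ⟨q, hq⟩ := rep_surj y
    exact ⟨q, x, hx, y, hq, hy⟩
  refine ⟨fun p => ⟨∃ x ∈ (rep p : Part X), x ∈ f.dom, fun hp => (h p hp).choose⟩, ?_, ?_⟩
  · intro p x hx hxf
    have hp : ∃ x ∈ (rep p : Part X), x ∈ f.dom := ⟨x, hx, hxf⟩
    obtain ⟨x', hx', y, hy, hyf⟩ := (h p hp).choose_spec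
    rw [Part.mem_unique hx hx']
    exact ⟨_, ⟨hp, rfl⟩, y, hy, hyf⟩
  · rintro p q ⟨hp, rfl⟩
    exact (h p hp).choose_spec

/-- A reduction as a statement about the names of a single instance. -/
theorem reducible_of_names {X Y U V : Type*} [RepresentedSpace X] [RepresentedSpace Y]
    [RepresentedSpace U] [RepresentedSpace V] {f : Problem X Y} {g : Problem U V}
    {H K : Baire → Baire} (hH : IsComputable fun p => Part.some (H p))
    (hK : IsComputable fun p => Part.some (K p))
    (h : ∀ p, ∀ x ∈ (rep p : Part X), x ∈ f.dom → ∃ z ∈ (rep (K p) : Part U), z ∈ g.dom ∧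
      ∀ q, ∀ y ∈ (rep q : Part V), y ∈ g z →
        ∃ y' ∈ (rep (H (interleave p q)) : Part Y), y' ∈ f x) : Reducible f g := by
  refine ⟨_, _, hH, hK, fun G hG p x hx hxf => ?_⟩
  obtain ⟨z, hz, hzg, hsol⟩ := h p x hx hxf
  obtain ⟨q, hq, y, hy, hyg⟩ := hG _ z hz hzg
  refine ⟨H (interleave p q), ?_, hsol q y hy hyg⟩
  simp only [Part.mem_bind_iff]
  exact ⟨K p, by simp, q, hq, by simp⟩

/-! ### Computably enumerable sets -/

theorem findIdx_range {P : ℕ → Bool} {n k : ℕ} (hk : k < n) (h : P k = true)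
    (h' : ∀ j < k, P j = false) : (List.range n).findIdx P = k := by
  rw [List.findIdx_eq (by simpa using hk)]
  simp only [List.getElem_range]
  exact ⟨h, h'⟩

theorem partrec_guard {α : Type*} [Primcodable α] {b : α → Bool} (hb : Computable b) :
    Partrec fun a => bif b a then Part.some 0 else (Part.none : Part ℕ) :=
  Partrec.cond hb (Computable.const 0).partrec Partrec.none

theorem guard_dom (b : Bool) : (bif b then Part.some 0 else (Part.none : Part ℕ)).Dom ↔ b := by
  cases b <;> simp

open Classical in
theorem jump_eq_zero {p : Baire} {i : ℕ} : jump p i = 0 ↔ i ∉ ceIn i p := by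
  unfold jump; split_ifs with h <;> simp [h]

/-- An index of the set enumerated with the help of a decidable predicate on words. -/
theorem exists_index {b : List ℕ → Bool} (hb : Computable b) :
    ∃ i, ∀ p n, n ∈ ceIn i p ↔ ∃ k, b (pre p k) = true := by
  have hp : Partrec fun x : ℕ => bif b (Denumerable.ofNat (List ℕ × ℕ) x).1 then Part.some 0
      else (Part.none : Part ℕ) :=
    partrec_guard (hb.comp (Computable.fst.comp (Computable.ofNat (List ℕ × ℕ))))
  obtain ⟨c, hc⟩ := Code.exists_code.1 (Partrec.nat_iff.1 hp)
  refine ⟨Encodable.encode c, fun p n => ?_⟩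
  simp only [ceIn, Set.mem_ofPred_eq, Denumerable.ofNat_encode, hc, guard_dom]

/-- The jump decides every c.e. property of its argument, in particular that the first entry equals
`q 0`. -/
theorem apply_zero_eq_of_jump_eq {p q : Baire} (h : jump p = jump q) : p 0 = q 0 := by
  have hb : Computable fun u : List ℕ => decide (u.head? = some (q 0)) :=
    (Primrec.eq.comp Primrec.list_head? (Primrec.const _)).decide.to_comp
  obtain ⟨i, hi⟩ := exists_index hb
  have hq : i ∈ ceIn i q := (hi q i).2 ⟨1, by simp [pre]⟩
  have hp : i ∈ ceIn i p := by
    by_contra hp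
    exact jump_eq_zero.1 (congrFun h i ▸ jump_eq_zero.2 hp) hq
  obtain ⟨k, hk⟩ := (hi p i).1 hp
  cases k with
  | zero => simp [pre] at hk
  | succ k => simpa [pre, List.range_succ_eq_map] using hk

/-! ### Limits of sequences in Baire space -/

theorem tendsto_baire_iff {p q : Baire} :
    Tendsto (fun n : ℕ => (fun k => p (Nat.pair n k) : Baire)) atTop (𝓝 q) ↔
      ∀ i, ∃ s₀, ∀ s ≥ s₀, p (Nat.pair s i) = q i := by
  rw [tendsto_pi_nhds]
  simp only [nhds_discrete, tendsto_pure, eventually_atTop]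

/-- The domain condition in the composition is automatic, because limits in Baire space are unique.
-/
theorem mem_low_iff {p q : Baire} : q ∈ Low p ↔ ∀ i, ∃ s₀, ∀ s ≥ s₀, p (Nat.pair s i) = jump q i := by
  rw [← tendsto_baire_iff]
  constructor
  · rintro ⟨-, y, hy, hq⟩
    have hq : jump q = y := hq
    exact hq ▸ hy
  · intro h
    refine ⟨fun y hy => ?_, _, h, rfl⟩
    rw [tendsto_nhds_unique hy h]
    exact ⟨q, rfl⟩

/-- The last entry of the `i`-th column of the sequence of sequences encoded in a word. -/
def columnValue (w : List ℕ) (i : ℕ) : ℕ :=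
  Nat.rec 1 (fun s a => (w[Nat.pair s i]?).getD a) w.length

/-- Entries outside `w` leave the current value unchanged, so once the stable part of the column is
reached the value is final. The initial value 1 does not matter here. -/
theorem columnValue_eq {w : List ℕ} {r : Baire} {i s₀ v : ℕ} (hr : ∀ s ≥ s₀, r (Nat.pair s i) = v)
    (hw : w <+: pre r w.length) (h : Nat.pair s₀ i < w.length) : columnValue w i = v := by
  have key : ∀ N, s₀ < N →
      (Nat.rec 1 (fun s a => (w[Nat.pair s i]?).getD a) N : ℕ) = v := by
    intro N hN
    induction N, hN using Nat.le_induction with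
    | base => simp [getElem?_of_prefix_pre hw h, hr s₀ le_rfl]
    | succ N hN ih =>
      change (w[Nat.pair N i]?).getD _ = v
      rw [ih]
      by_cases hl : Nat.pair N i < w.length
      · rw [getElem?_of_prefix_pre hw hl, hr N (by omega), Option.getD_some]
      · rw [List.getElem?_eq_none (not_lt.1 hl), Option.getD_none]
  exact key _ ((Nat.left_le_pair _ _).trans_lt h)

theorem primrec₂_columnValue : Primrec₂ columnValue := by
  refine Primrec.nat_rec' (f := fun x : List ℕ × ℕ => x.1.length)
    (h := fun x y => (x.1[Nat.pair y.1 x.2]?).getD y.2)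
    (Primrec.list_length.comp Primrec.fst) (Primrec.const 1) ?_
  refine Primrec.option_getD.comp (Primrec.list_getElem?.comp (Primrec.fst.comp Primrec.fst)
    (Primrec₂.natPair.comp (Primrec.fst.comp Primrec.snd) (Primrec.snd.comp Primrec.fst)))
    (Primrec.snd.comp Primrec.snd)

/-! ### The diagonal sequence -/

/-- The index of the section at `j` of the set enumerated by a code. -/
def sectionIndex (c : Code) (j : ℕ) : ℕ := Encodable.encode (c.curry j)

/-- The next value of the diagonal sequence: the opposite of the parity of the least number whose
section index has current column value `0`. -/
def opposite (c : Code) (w : List ℕ) (n : ℕ) : ℕ :=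
  1 - (List.range n).findIdx (fun j => columnValue w (sectionIndex c j) == 0) % 2

/-- The prefixes of the diagonal sequence. -/
def diagonalWord (φ : List ℕ → List ℕ) (c : Code) (n : ℕ) : List ℕ :=
  Nat.rec [] (fun n u => u ++ [opposite c (φ u) n]) n

/-- The diagonal sequence against the word function `φ` and the code `c`. -/
def diagonal (φ : List ℕ → List ℕ) (c : Code) : Baire :=
  fun n => opposite c (φ (diagonalWord φ c n)) n

theorem pre_diagonal (φ : List ℕ → List ℕ) (c : Code) (n : ℕ) :
    pre (diagonal φ c) n = diagonalWord φ c n := by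
  induction n with
  | zero => rfl
  | succ n ih => rw [pre_succ, ih]; rfl

theorem primrec_opposite : Primrec fun x : (Code × List ℕ) × ℕ => opposite x.1.1 x.1.2 x.2 := by
  refine Primrec.nat_sub.comp (Primrec.const 1) (Primrec.nat_mod.comp
    (Primrec.list_findIdx (Primrec.list_range.comp Primrec.snd) ?_) (Primrec.const 2))
  refine Primrec.beq.comp (primrec₂_columnValue.comp
    (Primrec.snd.comp (Primrec.fst.comp Primrec.fst)) (Primrec.encode.comp
      (Code.primrec₂_curry.comp (Primrec.fst.comp (Primrec.fst.comp Primrec.fst)) Primrec.snd)))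
    (Primrec.const 0)

theorem computable₂_diagonalWord {φ : List ℕ → List ℕ} (hφ : Computable φ) :
    Computable₂ (diagonalWord φ) := by
  have h₂ : Computable fun x : (Code × ℕ) × (ℕ × List ℕ) => x.2.2 :=
    Computable.snd.comp Computable.snd
  have h₁ : Computable fun x : (Code × ℕ) × (ℕ × List ℕ) => ((x.1.1, φ x.2.2), x.2.1) :=
    ((Computable.fst.comp Computable.fst).pair (hφ.comp h₂)).pair
      (Computable.fst.comp Computable.snd)
  have h₃ : ∀ f : (Code × List ℕ) × ℕ → ℕ, Computable f →
      Computable fun x : (Code × ℕ) × (ℕ × List ℕ) => f ((x.1.1, φ x.2.2), x.2.1) :=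
    fun f hf => hf.comp h₁
  have h₄ : Computable₂ fun (x : Code × ℕ) (y : ℕ × List ℕ) =>
      y.2 ++ [opposite x.1 (φ y.2) y.1] :=
    Computable.list_concat.comp h₂ (h₃ (fun x => opposite x.1.1 x.1.2 x.2)
      primrec_opposite.to_comp)
  exact Computable.nat_rec (f := fun x : Code × ℕ => x.2) (g := fun _ => ([] : List ℕ))
    Computable.snd (Computable.const []) h₄

/-- Some entry of `v` from position `j / 2` on differs from the parity of `j`. -/
def refutes (v : List ℕ) (j : ℕ) : Prop := ∃ a ∈ v.drop (j / 2), a ≠ j % 2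

theorem primrecRel_refutes : PrimrecRel refutes := by
  have h : PrimrecRel fun (v : List ℕ) (b : ℕ) => ∃ a ∈ v, a ≠ b :=
    PrimrecRel.exists_mem_list (R := fun a b : ℕ => a ≠ b) Primrec.eq.not
  exact h.comp (f := fun x : List ℕ × ℕ => x.1.drop (x.2 / 2)) (g := fun x => x.2 % 2)
    (Primrec.list_drop.comp (Primrec.nat_div.comp Primrec.snd (Primrec.const 2)) Primrec.fst)
    (Primrec.nat_mod.comp Primrec.snd (Primrec.const 2))

/-- A code that knows its own diagonal sequence: the section at `j` searches for a prefix of the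
oracle for which the output of `ψ` refutes `j`. -/
theorem exists_code_refutes {φ ψ : List ℕ → List ℕ} (hφ : Computable φ) (hψ : Computable ψ) :
    ∃ c : Code, ∀ q j, sectionIndex c j ∈ ceIn (sectionIndex c j) q ↔
      ∃ k, refutes (ψ (pre (interleave (diagonal φ c) q) (2 * k))) j := by
  classical
  let b : Code × ℕ → Bool := fun x =>
    decide (refutes (ψ (interleaveWord
      (diagonalWord φ x.1 (Denumerable.ofNat (List ℕ × ℕ) x.2.unpair.2).1.length)
      (Denumerable.ofNat (List ℕ × ℕ) x.2.unpair.2).1)) x.2.unpair.1)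
  have hb : Computable b := by
    have hu : Computable fun x : Code × ℕ =>
        (Denumerable.ofNat (List ℕ × ℕ) x.2.unpair.2).1 :=
      Computable.fst.comp ((Computable.ofNat (List ℕ × ℕ)).comp
        (Computable.snd.comp (Computable.unpair.comp Computable.snd)))
    exact Computable₂.comp (f := fun v j => decide (refutes v j))
      primrecRel_refutes.decide.to_comp
      (hψ.comp (primrec₂_interleaveWord.to_comp.comp
        ((computable₂_diagonalWord hφ).comp Computable.fst (Computable.list_length.comp hu)) hu))
      (Computable.fst.comp (Computable.unpair.comp Computable.snd))
  obtain ⟨c, hc⟩ := Code.fixed_point₂ (f := fun c n => bif b (c, n) then Part.some 0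
      else (Part.none : Part ℕ)) (partrec_guard hb)
  refine ⟨c, fun q j => ?_⟩
  simp only [ceIn, Set.mem_ofPred_eq, sectionIndex, Denumerable.ofNat_encode, Code.eval_curry, hc,
    guard_dom, b, Nat.unpair_pair, decide_eq_true_eq, length_pre, ← pre_diagonal,
    interleaveWord_pre, min_self]

theorem not_reducible_wbwt2_low : ¬ Reducible WBWT2 Low := by
  rintro ⟨H, K, ⟨ψ, hψ, ψmono, ψH⟩, ⟨φ, hφ, φmono, φK⟩, hred⟩
  obtain ⟨c, hc⟩ := exists_code_refutes hφ hψ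
  -- A realizer with no superfluous values: being defined at `r` already says that `r` is an
  -- instance and its value a solution.
  obtain ⟨G, hG, hGlow⟩ := exists_realizer Low
  set p := diagonal φ c with hp
  have hbin : ∀ n, p n = 0 ∨ p n = 1 := fun n => by
    simp only [hp, diagonal, opposite]; omega
  let x : ℕ → Bool := fun n => decide (p n = 1)
  have hx : x ∈ (rep p : Part (ℕ → Bool)) := ⟨hbin, rfl⟩
  have hdom : x ∈ WBWT2.dom := by
    have : ∃ i, MapClusterPt i atTop x := by
      obtain ⟨i, -, hi⟩ := isCompact_univ (X := Bool) (f := map x atTop) (by simp)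
      exact ⟨i, hi⟩
    obtain ⟨i, hi⟩ := this
    exact ⟨fun _ => i, i, tendsto_const_nhds, hi⟩
  obtain ⟨s, hs, y, hy, i, hlim, hclus⟩ := hred G hG p x hx hdom
  obtain ⟨r, hr, hs⟩ := Part.mem_bind_iff.1 hs
  obtain ⟨q, hq, hs⟩ := Part.mem_bind_iff.1 hs
  have hlow : ∀ i, ∃ s₀, ∀ s ≥ s₀, r (Nat.pair s i) = jump q i := by
    obtain ⟨r', hr', q', hq', h⟩ := hGlow r q hq
    rw [Part.mem_some_iff.1 hr', Part.mem_some_iff.1 hq'] at h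
    exact mem_low_iff.1 h
  -- the columns with limit `0` are those describing `s`
  have hzero : ∀ j, jump q (sectionIndex c j) = 0 ↔ ∀ m ≥ j / 2, s m = j % 2 := by
    intro j
    rw [jump_eq_zero, hc]
    constructor
    · intro h m hm
      by_contra hne
      obtain ⟨n, hn⟩ := ψH _ s hs (m + 1)
      -- A wrong entry `s m` shows up in the output of `ψ` after finitely many steps, which refutes
      -- `j`.
      refine h ⟨n, s m, ?_, hne⟩
      have h₁ := getElem?_of_pre_prefix (hn.trans (ψmono _ _ (pre_prefix_pre _
        (by omega : n ≤ 2 * n)))) (Nat.lt_succ_self m)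
      refine List.mem_of_getElem? (i := m - j / 2) ?_
      rw [List.getElem?_drop, Nat.add_sub_cancel' hm, h₁]
    · rintro h ⟨k, a, ha, hne⟩
      obtain ⟨m, hm⟩ := List.mem_iff_getElem?.1 ha
      rw [List.getElem?_drop] at hm
      have hlt := (List.getElem?_eq_some_iff.1 hm).1
      rw [getElem?_of_prefix_pre (prefix_pre_of_approx ψmono (ψH _ s hs) _) hlt] at hm
      exact hne (by rw [← Option.some.inj hm]; exact h _ (by omega))
  -- some column has limit `0`
  have hyev : ∃ m₀, ∀ m ≥ m₀, s m = i.toNat := by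
    rw [nhds_discrete, tendsto_pure, eventually_atTop] at hlim
    obtain ⟨m₀, h⟩ := hlim
    obtain ⟨hsbin, rfl⟩ := hy
    refine ⟨m₀, fun m hm => ?_⟩
    have h₁ : decide (s m = 1) = i := h m hm
    rcases hsbin m with h₂ | h₂ <;> simp [← h₁, h₂]
  obtain ⟨m₀, hm₀⟩ := hyev
  have hex : ∃ j, jump q (sectionIndex c j) = 0 := by
    -- Half of the witness is the stabilization point of `s`, its parity the limit.
    refine ⟨2 * m₀ + i.toNat, (hzero _).2 fun m hm => ?_⟩
    have := i.toNat_lt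
    rw [hm₀ m (by omega)]
    omega
  classical
  let j := Nat.find hex
  have hj : jump q (sectionIndex c j) = 0 := Nat.find_spec hex
  have hj' : ∀ l < j, jump q (sectionIndex c l) ≠ 0 := fun l hl => Nat.find_min hex hl
  have hpar : j % 2 = i.toNat := by
    rw [← (hzero j).1 hj (max m₀ (j / 2)) (le_max_right _ _), hm₀ _ (le_max_left _ _)]
  -- the approximations to the columns up to `j` are eventually correct
  have hcol : ∀ l, ∃ N, ∀ n ≥ N,
      columnValue (φ (diagonalWord φ c n)) (sectionIndex c l) = jump q (sectionIndex c l) := by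
    intro l
    obtain ⟨s₀, hs₀⟩ := hlow (sectionIndex c l)
    obtain ⟨N, hN⟩ := φK p r hr (Nat.pair s₀ (sectionIndex c l) + 1)
    refine ⟨N, fun n hn => ?_⟩
    rw [← pre_diagonal]
    refine columnValue_eq hs₀ (prefix_pre_of_approx φmono (φK p r hr) n) ?_
    have := (hN.trans (φmono _ _ (pre_prefix_pre p hn))).length_le
    rw [length_pre] at this
    exact Nat.lt_of_succ_le this
  choose N hN using hcol
  obtain ⟨M, hM⟩ : ∃ M, ∀ l ≤ j, N l ≤ M :=
    ⟨(Finset.range (j + 1)).sup N, fun l hl =>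
      Finset.le_sup (f := N) (Finset.mem_range.2 (Nat.lt_succ_of_le hl))⟩
  -- From stage `M` on all columns up to `j` are correct, and `j + 1` puts `j` inside the search
  -- range, so the search returns exactly `j`.
  have hpn : ∀ n ≥ max M (j + 1), p n = 1 - i.toNat := by
    intro n hn
    have hnM : M ≤ n := (le_max_left _ _).trans hn
    have hnj : j < n := (le_max_right _ _).trans hn
    change opposite c (φ (diagonalWord φ c n)) n = _
    rw [opposite, findIdx_range hnj, hpar]
    · rw [hN j n ((hM j le_rfl).trans hnM), hj]; rfl
    · intro l hl
      rw [hN l n ((hM l hl.le).trans hnM)]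
      simpa using hj' l hl
  have hfreq : ∃ᶠ n in atTop, x n = i := by
    have := mapClusterPt_iff_frequently.1 hclus {i} (by simp)
    simpa using this
  obtain ⟨n, hn, hxi⟩ := (frequently_atTop.1 hfreq) (max M (j + 1))
  have h₁ := hpn n hn
  have h₂ : decide (p n = 1) = i := hxi
  cases i <;> simp [h₁] at h₂

/-! ### Problems above the weak Bolzano–Weierstraß problem -/

theorem mapClusterPt_bool_iff {x : ℕ → Bool} {i : Bool} :
    MapClusterPt i atTop x ↔ ∃ᶠ n in atTop, x n = i := by
  rw [mapClusterPt_iff_frequently]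
  refine ⟨fun h => by simpa using h {i} (by simp), fun h s hs => h.mono fun n hn => ?_⟩
  rw [hn]
  exact mem_of_mem_nhds hs

theorem isComputable_id : IsComputable fun p => Part.some p :=
  isComputable_of_prefix (F := fun p => p) (h := fun u => u.getD (u.length / 2 - 1) 0)
    ((Primrec.list_getD 0).comp Primrec.id (Primrec.nat_sub.comp
      (Primrec.nat_div.comp Primrec.list_length (Primrec.const 2)) (Primrec.const 1)))
    fun p n => by
      rw [length_pre, getD_pre (by omega)]
      congr 1
      omega

theorem isComputable_add_one {K : Baire → Baire} (hK : IsComputable fun p => Part.some (K p)) :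
    IsComputable fun p => Part.some fun n => K p n + 1 := by
  have h : IsComputable fun p => Part.some fun n => p n + 1 :=
    isComputable_of_prefix (F := fun p n => p n + 1)
      (h := fun u => u.getD (u.length / 2 - 1) 0 + 1)
      (Primrec.succ.comp ((Primrec.list_getD 0).comp Primrec.id (Primrec.nat_sub.comp
        (Primrec.nat_div.comp Primrec.list_length (Primrec.const 2)) (Primrec.const 1))))
      fun p n => by
        rw [length_pre, getD_pre (by omega)]
        congr 2
        omega
  simpa using h.comp hK

/-- The sorted sequence is itself a solution: it converges to 1 or 0 according to whether the zeros
are finitely or infinitely many. -/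
theorem wbwt2_reducible_sort : Reducible WBWT2 SORT := by
  refine reducible_of_names isComputable_odds isComputable_id fun p x hx _ =>
    ⟨x, hx, ⟨_, rfl⟩, fun q y hy hyx => ⟨y, by simpa using hy, ?_⟩⟩
  have hyx : y = _ := hyx
  by_cases hfin : {n | x n = false}.Finite
  · rw [if_pos hfin] at hyx
    refine ⟨true, ?_, ?_⟩
    · rw [nhds_discrete, tendsto_pure, eventually_atTop]
      exact ⟨_, fun n hn => by rw [hyx]; exact decide_eq_true hn⟩
    · rw [mapClusterPt_bool_iff]
      have h : ∀ᶠ n in atTop, ¬ x n = false := by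
        rw [← Nat.cofinite_eq_atTop]
        exact hfin.compl_mem_cofinite
      exact (h.mono fun n hn => by simpa using hn).frequently
  · rw [if_neg hfin] at hyx
    refine ⟨false, hyx ▸ tendsto_const_nhds, ?_⟩
    rw [mapClusterPt_bool_iff, Nat.frequently_atTop_iff_infinite]
    exact hfin

/-- The first positive entry of a word, or `0` if there is none. -/
def firstPos (u : List ℕ) : ℕ := u.getD (u.findIdx fun a => a != 0) 0

theorem firstPos_pre {q : Baire} {j n : ℕ} (hj : q j ≠ 0) (h : ∀ i < j, q i = 0) (hn : j < n) :
    firstPos (pre q n) = q j := by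
  have : (pre q n).findIdx (fun a => a != 0) = j := by
    rw [pre, List.findIdx_map]
    exact findIdx_range hn (by simpa using hj) fun i hi => by simp [h i hi]
  rw [firstPos, this, getD_pre hn]

theorem firstPos_pre_eq_zero {q : Baire} (h : ∀ i, q i = 0) (n : ℕ) : firstPos (pre q n) = 0 := by
  by_cases hn : (pre q n).findIdx (fun a => a != 0) < n
  · rw [firstPos, getD_pre hn, h]
  · simp [firstPos, not_lt.1 hn]

theorem primrec_firstPos : Primrec firstPos :=
  (Primrec.list_getD 0).comp Primrec.id (Primrec.list_findIdx Primrec.id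
    ((Primrec.not.comp (Primrec.beq.comp Primrec.snd (Primrec.const 0))).of_eq fun _ => rfl))

theorem forall_mem_drop_pre {p : Baire} {k n : ℕ} :
    (∀ a ∈ (pre p n).drop k, a = 1) ↔ ∀ i, k ≤ i → i < n → p i = 1 := by
  constructor
  · intro h i hk hn
    refine h _ (List.mem_of_getElem? (i := i - k) ?_)
    rw [List.getElem?_drop, Nat.add_sub_cancel' hk, getElem?_pre hn]
  · intro h a ha
    obtain ⟨m, hm⟩ := List.mem_iff_getElem?.1 ha
    rw [List.getElem?_drop] at hm
    have hlt : k + m < n := by simpa using (List.getElem?_eq_some_iff.1 hm).1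
    rw [getElem?_pre hlt] at hm
    rw [← Option.some.inj hm]
    exact h _ (by omega) hlt

theorem primrecRel_forall_mem_drop :
    PrimrecRel fun (u : List ℕ) (k : ℕ) => ∀ a ∈ u.drop k, a = 1 := by
  have h : PrimrecPred fun u : List ℕ => ∀ a ∈ u, a = 1 :=
    PrimrecPred.forall_mem_list (p := fun a : ℕ => a = 1)
      (Primrec.eq.comp Primrec.id (Primrec.const 1))
  exact h.comp (f := fun x : List ℕ × ℕ => x.1.drop x.2)
    (Primrec.list_drop.comp Primrec.snd Primrec.fst)

open Classical in
/-- Checks whether the bound guessed by the word `v` is consistent with `u` having only entries `1`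
from there on. -/
noncomputable def checkBound (u v : List ℕ) : ℕ :=
  if firstPos v ≠ 0 ∧ ∀ a ∈ u.drop (firstPos v - 1), a = 1 then 1 else 0

theorem primrec₂_checkBound : Primrec₂ checkBound := by
  have h : Primrec fun x : List ℕ × List ℕ => firstPos x.2 := primrec_firstPos.comp Primrec.snd
  have hp : PrimrecPred fun x : List ℕ × List ℕ =>
      firstPos x.2 ≠ 0 ∧ ∀ a ∈ x.1.drop (firstPos x.2 - 1), a = 1 :=
    (Primrec.eq.comp h (Primrec.const 0)).not.and
      (primrecRel_forall_mem_drop.comp Primrec.fst (Primrec.nat_sub.comp h (Primrec.const 1)))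
  exact (Primrec.ite hp (Primrec.const 1) (Primrec.const 0)).of_eq fun x => by
    unfold checkBound
    congr

/-- Checks the bound guessed by `q` against longer and longer prefixes of `p`, where the argument
is the pair of `p` and `q`. -/
noncomputable def checkBounds (s : Baire) : Baire :=
  fun n => checkBound (pre (evens s) (n + 1)) (pre (odds s) (n + 1))

theorem isComputable_checkBounds : IsComputable fun s => Part.some (checkBounds s) := by
  have hr : Primrec fun u : List ℕ => List.range (u.length / 2) :=
    Primrec.list_range.comp (Primrec.nat_div.comp Primrec.list_length (Primrec.const 2))
  have h2 : Primrec fun x : List ℕ × ℕ => 2 * x.2 :=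
    Primrec.nat_mul.comp (Primrec.const 2) Primrec.snd
  refine isComputable_of_prefix (h := fun u => checkBound
    ((List.range (u.length / 2)).map fun i => u.getD (2 * i) 0)
    ((List.range (u.length / 2)).map fun i => u.getD (2 * i + 1) 0))
    (primrec₂_checkBound.comp
      (Primrec.list_map hr ((Primrec.list_getD 0).comp Primrec.fst h2))
      (Primrec.list_map hr ((Primrec.list_getD 0).comp Primrec.fst (Primrec.succ.comp h2)))) ?_
  intro s n
  have hn : (pre s (2 * n + 2)).length / 2 = n + 1 := by rw [length_pre]; omega
  rw [hn, checkBounds]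
  congr 1
  · refine List.map_congr_left fun i hi => ?_
    rw [getD_pre (by have := List.mem_range.1 hi; omega)]
    rfl
  · refine List.map_congr_left fun i hi => ?_
    rw [getD_pre (by have := List.mem_range.1 hi; omega)]
    rfl

theorem checkBounds_binary (s : Baire) (n : ℕ) : checkBounds s n = 0 ∨ checkBounds s n = 1 := by
  unfold checkBounds checkBound
  split_ifs <;> simp

/-- If `q` guesses a correct bound, then the check succeeds eventually. -/
theorem checkBounds_eventually_one {p q : Baire} {j : ℕ} (hj : q j ≠ 0) (h : ∀ i < j, q i = 0)
    (hp : ∀ n ≥ q j - 1, p n = 1) : ∀ n ≥ j, checkBounds (interleave p q) n = 1 := by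
  intro n hn
  rw [checkBounds, evens_interleave, odds_interleave, checkBound, firstPos_pre hj h (by omega)]
  exact if_pos ⟨hj, forall_mem_drop_pre.2 fun i hi _ => hp i hi⟩

/-- If there is no correct bound, then the check fails eventually. -/
theorem checkBounds_eventually_zero {p q : Baire} (hp : ∀ k, ∃ n ≥ k, p n ≠ 1) :
    ∃ m, ∀ n ≥ m, checkBounds (interleave p q) n = 0 := by
  simp only [checkBounds, evens_interleave, odds_interleave, checkBound]
  by_cases hq : ∀ i, q i = 0
  · exact ⟨0, fun n _ => if_neg fun h => h.1 (firstPos_pre_eq_zero hq _)⟩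
  · push Not at hq
    classical
    obtain ⟨m, hm, hpm⟩ := hp (q (Nat.find hq) - 1)
    -- By this stage both the guess and a position `m` refuting it are visible.
    refine ⟨max m (Nat.find hq), fun n hn => if_neg fun h => hpm ?_⟩
    have hl := h.2
    rw [firstPos_pre (Nat.find_spec hq) (fun i hi => by simpa using Nat.find_min hq hi)
      (by omega)] at hl
    exact forall_mem_drop_pre.1 hl m hm (by omega)

theorem exists_first_of_mem_decr {q r : Baire} (h : r ∈ decr q) :
    ∃ j, q j ≠ 0 ∧ (∀ i < j, q i = 0) ∧ r 0 = q j - 1 := by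
  obtain ⟨hinf, rfl⟩ := h
  refine ⟨Nat.nth (fun n => q n ≠ 0) 0, Nat.nth_mem_of_infinite hinf 0, fun i hi => ?_, rfl⟩
  by_contra hne
  rw [Nat.nth_zero] at hi
  exact absurd (Nat.sInf_le (s := {n | q n ≠ 0}) hne) (not_le.2 hi)

theorem completion_dom {X Y : Type*} (f : Problem X Y)
    (z : Completion X) : z ∈ f.completion.dom := by
  cases z with
  | none => exact ⟨none, trivial⟩
  | some x =>
    by_cases hx : x ∈ f.dom
    · obtain ⟨y, hy⟩ := hx
      exact ⟨some y, by simpa [Problem.completion, show x ∈ f.dom from ⟨y, hy⟩] using hy⟩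
    · exact ⟨none, by simp [Problem.completion, hx]⟩

/-- The weak Bolzano–Weierstraß problem reduces to the completion of every problem that can be used
to bound the zeros of those sequences that have only finitely many of them. -/
theorem wbwt2_reducible_completion {X Y : Type*} [RepresentedSpace X] [RepresentedSpace Y]
    {f : Problem X Y} {K : Baire → Baire} (hK : IsComputable fun p => Part.some (K p))
    (h : ∀ p : Baire, (∃ k, ∀ n ≥ k, p n = 1) → ∃ x ∈ (rep (K p) : Part X), x ∈ f.dom ∧
      ∀ q, ∀ y ∈ (rep q : Part Y), y ∈ f x → ∀ n ≥ q 0, p n = 1) :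
    Reducible WBWT2 f.completion := by
  refine reducible_of_names isComputable_checkBounds (isComputable_add_one hK)
    fun p x hx _ => ⟨_, Part.mem_some _, completion_dom f _, fun q z hz hzf => ?_⟩
  refine ⟨fun n => decide (checkBounds (interleave p q) n = 1),
    ⟨checkBounds_binary _, rfl⟩, ?_⟩
  obtain ⟨hbin, rfl⟩ := hx
  by_cases hp : ∃ k, ∀ n ≥ k, p n = 1
  · obtain ⟨x, hx, hxf, hsol⟩ := h p hp
    -- The shift by one turns a name of `x` into a name of `some x`.
    have hpx : x ∈ precompletion X fun n => K p n + 1 := Part.mem_bind (decr_succ _) hx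
    classical
    have hto : (precompletion X fun n => K p n + 1).toOption = some x :=
      Part.toOption_eq_some_iff.2 hpx
    obtain ⟨y, hy, rfl⟩ : ∃ y ∈ f x, some y = z := by
      have h' : z ∈ f.completion (some x) := by
        convert hzf
        exact hto.symm
      simpa [Problem.completion, hxf] using h'
    have hqy : y ∈ precompletion Y q := Part.toOption_eq_some_iff.1 (Part.mem_some_iff.1 hz).symm
    obtain ⟨r, hr, hry⟩ := Part.mem_bind_iff.1 hqy
    obtain ⟨j, hj, hj', hrj⟩ := exists_first_of_mem_decr hr
    have hone := checkBounds_eventually_one hj hj' (hrj ▸ hsol r y hry hy)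
    refine ⟨true, ?_, ?_⟩
    · rw [nhds_discrete, tendsto_pure, eventually_atTop]
      exact ⟨j, fun n hn => decide_eq_true (hone n hn)⟩
    · obtain ⟨k, hk⟩ := hp
      rw [mapClusterPt_bool_iff]
      exact (eventually_atTop.2 ⟨k, fun n hn => decide_eq_true (hk n hn)⟩).frequently
  · push Not at hp
    -- Nothing is known about `q` in this case, and nothing is needed.
    obtain ⟨m, hm⟩ := checkBounds_eventually_zero (q := q) hp
    refine ⟨false, ?_, ?_⟩
    · rw [nhds_discrete, tendsto_pure, eventually_atTop]
      exact ⟨m, fun n hn => by simp [hm n hn]⟩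
    · rw [mapClusterPt_bool_iff, frequently_atTop]
      intro k
      obtain ⟨n, hn, hpn⟩ := hp k
      exact ⟨n, hn, decide_eq_false hpn⟩

/-! ### Closed choice on the natural numbers -/

/-- A name of the set of bounds for the positions of the entries of `p` different from `1`. -/
def boundsName (p : Baire) : Baire := fun n =>
  if n.unpair.1 ≤ n.unpair.2 ∧ p n.unpair.2 ≠ 1 then n.unpair.1 + 1 else 0

theorem isComputable_boundsName : IsComputable fun p => Part.some (boundsName p) := by
  have hn : Primrec fun u : List ℕ => (u.length / 2 - 1).unpair :=
    Primrec.unpair.comp (Primrec.nat_sub.comp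
      (Primrec.nat_div.comp Primrec.list_length (Primrec.const 2)) (Primrec.const 1))
  refine isComputable_of_prefix (h := fun u =>
    if (u.length / 2 - 1).unpair.1 ≤ (u.length / 2 - 1).unpair.2 ∧
      u.getD (u.length / 2 - 1).unpair.2 0 ≠ 1 then (u.length / 2 - 1).unpair.1 + 1 else 0)
    (Primrec.ite ((Primrec.nat_le.comp (Primrec.fst.comp hn) (Primrec.snd.comp hn)).and
      (Primrec.eq.comp ((Primrec.list_getD 0).comp Primrec.id (Primrec.snd.comp hn))
        (Primrec.const 1)).not) (Primrec.succ.comp (Primrec.fst.comp hn)) (Primrec.const 0)) ?_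
  intro p n
  have h : (pre p (2 * n + 2)).length / 2 - 1 = n := by rw [length_pre]; omega
  have := Nat.unpair_right_le n
  rw [h, getD_pre (by omega), boundsName]

theorem wbwt2_reducible_choiceNat_completion : Reducible WBWT2 choiceNat.completion := by
  refine wbwt2_reducible_completion isComputable_boundsName ?_
  rintro p ⟨k, hk⟩
  refine ⟨_, Part.mem_some _, ⟨k, ?_⟩, ?_⟩
  · rintro ⟨n, hn⟩
    unfold boundsName at hn
    split_ifs at hn with h
    · exact h.2 (hk _ (by omega))
  · intro q y hy hyA n hn
    rw [← Part.mem_some_iff.1 hy] at hn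
    by_contra hne
    -- Position `Nat.pair y n` is where the entry `p n ≠ 1` removes `y` from the set.
    exact hyA ⟨Nat.pair y n, by simp [boundsName, hne, show y ≤ n from hn]⟩

/-! ### The completion of the low map -/

/-- The least bound for the positions of the entries of a word different from `1`. -/
def leastBound (u : List ℕ) : ℕ :=
  (List.range (u.length + 1)).findIdx fun k => decide (∀ a ∈ u.drop k, a = 1)

theorem primrec_leastBound : Primrec leastBound :=
  Primrec.list_findIdx (Primrec.list_range.comp (Primrec.succ.comp Primrec.list_length))
    primrecRel_forall_mem_drop.decide

/-- The last entry different from 1, if any, sits just below the least bound `k`; a prefix of length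
at least `k` contains it, which rules out all smaller candidates. -/
theorem exists_leastBound {p : Baire} (hp : ∃ k, ∀ n ≥ k, p n = 1) :
    ∃ k, (∀ n ≥ k, p n = 1) ∧ ∀ t ≥ k, leastBound (pre p t) = k := by
  classical
  refine ⟨Nat.find hp, Nat.find_spec hp, fun t ht => ?_⟩
  have hspec := Nat.find_spec hp
  rw [leastBound, length_pre]
  refine findIdx_range (by omega)
    (decide_eq_true (forall_mem_drop_pre.2 fun i hi _ => hspec i hi)) fun j hj => ?_
  refine decide_eq_false fun hall => ?_
  have hmin := Nat.find_min hp (m := Nat.find hp - 1) (by omega)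
  refine hmin fun n hn => ?_
  by_cases hn' : Nat.find hp ≤ n
  · exact hspec n hn'
  · exact forall_mem_drop_pre.1 hall n (by omega) (by omega)

/-- The program with index `i` halts within `t` steps on `i` and a prefix of length less than `t` of
the constant sequence with value `k`. -/
def HaltsBefore (k t i : ℕ) : Prop :=
  ∃ s < t, (Code.evaln t (Denumerable.ofNat Code i)
    (Encodable.encode (pre (fun _ => k) s, i))).isSome = true

theorem primrecPred_haltsBefore :
    PrimrecPred fun y : ℕ × ℕ × ℕ => HaltsBefore y.1 y.2.1 y.2.2 := by
  have hR : PrimrecRel fun (s : ℕ) (y : ℕ × ℕ × ℕ) =>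
      (Code.evaln y.2.1 (Denumerable.ofNat Code y.2.2)
        (Encodable.encode (pre (fun _ => y.1) s, y.2.2))).isSome = true := by
    have ht : Primrec fun x : ℕ × ℕ × ℕ × ℕ => x.2.2.1 :=
      Primrec.fst.comp (Primrec.snd.comp Primrec.snd)
    have hi : Primrec fun x : ℕ × ℕ × ℕ × ℕ => x.2.2.2 :=
      Primrec.snd.comp (Primrec.snd.comp Primrec.snd)
    have hw : Primrec fun x : ℕ × ℕ × ℕ × ℕ => pre (fun _ => x.2.1) x.1 :=
      Primrec.list_map (Primrec.list_range.comp Primrec.fst)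
        (Primrec.fst.comp (Primrec.snd.comp Primrec.fst))
    exact Primrec.eq.comp (Primrec.option_isSome.comp (Code.primrec_evaln.comp
      ((ht.pair ((Primrec.ofNat Code).comp hi)).pair (Primrec.encode.comp (hw.pair hi)))))
      (Primrec.const true)
  exact (hR.exists_mem_list.comp (f := fun y : ℕ × ℕ × ℕ => List.range y.2.1) (g := fun y => y)
    (Primrec.list_range.comp (Primrec.fst.comp Primrec.snd)) Primrec.id).of_eq fun y => by
      simp [HaltsBefore]

-- The jump is limit computable: step-bounded halting is monotone in the bound and eventually
-- detects every halting computation.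
open Classical in
theorem haltsBefore_tendsto (k i : ℕ) :
    ∃ t₀, ∀ t ≥ t₀, (if HaltsBefore k t i then 1 else 0) = jump (fun _ => k) i := by
  by_cases hi : i ∈ ceIn i fun _ => k
  · obtain ⟨s, hs⟩ := hi
    obtain ⟨v, hv⟩ := Part.dom_iff_mem.1 hs
    obtain ⟨t₁, ht₁⟩ := Code.evaln_complete.1 hv
    refine ⟨max t₁ (s + 1), fun t ht => ?_⟩
    have hh : HaltsBefore k t i :=
      ⟨s, by omega, Option.isSome_iff_exists.2 ⟨v, Code.evaln_mono (by omega) ht₁⟩⟩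
    rw [if_pos hh, jump, if_pos ⟨s, hs⟩]
  · refine ⟨0, fun t _ => ?_⟩
    rw [jump, if_neg hi, if_neg]
    rintro ⟨s, -, hs⟩
    obtain ⟨v, hv⟩ := Option.isSome_iff_exists.1 hs
    exact hi ⟨s, Part.dom_iff_mem.2 ⟨v, Code.evaln_sound hv⟩⟩

open Classical in
/-- Approximations to the jump of the constant sequence whose value is the least bound for the
positions of the entries of `p` different from `1`. -/
noncomputable def boundJump (p : Baire) : Baire := fun n =>
  if HaltsBefore (leastBound (pre p n.unpair.1)) n.unpair.1 n.unpair.2 then 1 else 0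

theorem isComputable_boundJump : IsComputable fun p => Part.some (boundJump p) := by
  classical
  have hn : Primrec fun u : List ℕ => (u.length / 2 - 1).unpair :=
    Primrec.unpair.comp (Primrec.nat_sub.comp
      (Primrec.nat_div.comp Primrec.list_length (Primrec.const 2)) (Primrec.const 1))
  have hp : PrimrecPred fun u : List ℕ => HaltsBefore
      (leastBound (u.take (u.length / 2 - 1).unpair.1))
      (u.length / 2 - 1).unpair.1 (u.length / 2 - 1).unpair.2 :=
    primrecPred_haltsBefore.comp (f := fun u : List ℕ =>
      (leastBound (u.take (u.length / 2 - 1).unpair.1), (u.length / 2 - 1).unpair))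
      ((primrec_leastBound.comp (Primrec.list_take.comp (Primrec.fst.comp hn) Primrec.id)).pair hn)
  refine isComputable_of_prefix (Primrec.ite hp (Primrec.const 1) (Primrec.const 0)) ?_
  intro p n
  have h : (pre p (2 * n + 2)).length / 2 - 1 = n := by rw [length_pre]; omega
  have := Nat.unpair_left_le n
  rw [h, take_pre _ (by omega), boundJump]

/-- The least bound `k` is found in the limit, hence so is the jump of the constant sequence `k`.
Any solution has that same jump, so its first entry is `k`. -/
theorem wbwt2_reducible_low_completion : Reducible WBWT2 Low.completion := by
  refine wbwt2_reducible_completion isComputable_boundJump fun p hp => ?_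
  obtain ⟨k, hk, hlb⟩ := exists_leastBound hp
  have hlim : ∀ i, ∃ s₀, ∀ s ≥ s₀, boundJump p (Nat.pair s i) = jump (fun _ => k) i := by
    intro i
    obtain ⟨t₀, ht₀⟩ := haltsBefore_tendsto k i
    refine ⟨max t₀ k, fun s hs => ?_⟩
    rw [← ht₀ s (by omega), boundJump, Nat.unpair_pair, hlb s (by omega)]
  have hmem : (fun _ => k) ∈ Low (boundJump p) := mem_low_iff.2 hlim
  refine ⟨_, Part.mem_some _, ⟨_, hmem⟩, fun q y hy hyL n hn => ?_⟩
  rw [Part.mem_some_iff.1 hy] at hyL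
  have hj : jump q = jump fun _ => k :=
    tendsto_nhds_unique (tendsto_baire_iff.2 (mem_low_iff.1 hyL)) (tendsto_baire_iff.2 hlim)
  rw [apply_zero_eq_of_jump_eq hj] at hn
  exact hk n hn

end Weihrauch

theorem proposition9p5 :
    ¬ Weihrauch.Reducible Weihrauch.WBWT2 Weihrauch.Low ∧
    ¬ Weihrauch.Low.IsComplete ∧
    ¬ Weihrauch.Reducible Weihrauch.choiceNat.completion Weihrauch.Low ∧
    ¬ Weihrauch.Reducible Weihrauch.SORT Weihrauch.Low :=
  ⟨Weihrauch.not_reducible_wbwt2_low,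
    fun h => Weihrauch.not_reducible_wbwt2_low (Weihrauch.wbwt2_reducible_low_completion.trans h.2),
    fun h => Weihrauch.not_reducible_wbwt2_low
      (Weihrauch.wbwt2_reducible_choiceNat_completion.trans h),
    fun h => Weihrauch.not_reducible_wbwt2_low (Weihrauch.wbwt2_reducible_sort.trans h)⟩
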